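/- Let $\omega$ be a non-principal ultrafilter on $\mathbb{N}$, let $(A_i)_{i\in\mathbb{N}}$ be compact Hausdorff abelian groups, and let $\mathbf{A}=\prod_\omega A_i$ be their ultraproduct (sequences modulo equality on a set of indices in $\omega$), with the coordinatewise group structure. Call a subset of $\mathbf{A}$ strongly open if it is an ultraproduct $\prod_\omega U_i$ of open sets $U_i\subseteq A_i$, and open (in the $\sigma$-topology) if it is a countable union of strongly open sets; let the Borel sets of $\mathbf{A}$ be the $\sigma$-algebra generated by the strongly open sets. Let $\mathcal{C}=\{z\in\mathbb{C}:|z|=1\}$. A linear character of $A_i$ is a continuous homomorphism $A_i\to\mathcal{C}$. A linear character of $\mathbf{A}$ is a homomorphism $\chi:\mathbf{A}\to\mathcal{C}\subset\mathbb{C}$ such that $\chi^{-1}(V)$ is open in the $\sigma$-topology for every open $V\subseteq\mathcal{C}$. For functions $\chi_i:A_i\to\mathcal{C}$, the ultralimit $\lim_\omega\chi_i:\mathbf{A}\to\mathcal{C}$ sends the class of $(x_i)_i$ to $\lim_\omega\chi_i(x_i)$. Then a function $\chi:\mathbf{A}\to\mathbb{C}$ is a linear character of $\mathbf{A}$ if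 and only if $\chi=\lim_\omega\chi_i$ (everywhere on $\mathbf{A}$) for some sequence of linear characters $\chi_i$ of $A_i$. Moreover every linear character of $\mathbf{A}$ is Borel measurable and of modulus $1$ everywhere, so it is automatically a bounded measurable function on $\mathbf{A}$. -/

import Mathlib

open Filter Topology
open scoped MeasureTheory

universe u v

/-- The ultraproduct `∏_ω X i`: sequences modulo equality on a set of indices in `ω`. -/
abbrev Ultraproduct (ω : Ultrafilter ℕ) (X : ℕ → Type u) : Type u :=
  (ω : Filter ℕ).Product X

namespace Ultraproduct

variable (ω : Ultrafilter ℕ)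

/-- The class of a sequence in the ultraproduct. -/
def mk {X : ℕ → Type u} (x : ∀ i, X i) : Ultraproduct ω X :=
  Quotient.mk ((ω : Filter ℕ).productSetoid X) x

/-- Coordinatewise addition. -/
instance instAdd (A : ℕ → Type u) [∀ i, AddCommGroup (A i)] : Add (Ultraproduct ω A) where
  add := Quotient.map₂ (fun x y i => x i + y i) (by
    intro x x' hx y y' hy
    filter_upwards [hx, hy] with i h₁ h₂
    rw [h₁, h₂])

instance instZero (A : ℕ → Type u) [∀ i, AddCommGroup (A i)] : Zero (Ultraproduct ω A) where
  zero := mk ω (fun _ => 0)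

/-- Coordinatewise negation. -/
instance instNeg (A : ℕ → Type u) [∀ i, AddCommGroup (A i)] : Neg (Ultraproduct ω A) where
  neg := Quotient.map (fun x i => -x i) (by
    intro x x' hx
    filter_upwards [hx] with i h₁
    rw [h₁])

/-- The coordinatewise group structure on the ultraproduct of abelian groups. -/
instance instAddCommGroup (A : ℕ → Type u) [∀ i, AddCommGroup (A i)] :
    AddCommGroup (Ultraproduct ω A) where
  nsmul := nsmulRec
  zsmul := zsmulRec
  add_assoc := by
    rintro ⟨x⟩ ⟨y⟩ ⟨z⟩
    exact congrArg (mk ω) (funext fun i => add_assoc (x i) (y i) (z i))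
  zero_add := by
    rintro ⟨x⟩
    exact congrArg (mk ω) (funext fun i => zero_add (x i))
  add_zero := by
    rintro ⟨x⟩
    exact congrArg (mk ω) (funext fun i => add_zero (x i))
  neg_add_cancel := by
    rintro ⟨x⟩
    exact congrArg (mk ω) (funext fun i => neg_add_cancel (x i))
  add_comm := by
    rintro ⟨x⟩ ⟨y⟩
    exact congrArg (mk ω) (funext fun i => add_comm (x i) (y i))

/-- The ultraproduct of subsets `S i ⊆ X i`, as a subset of the ultraproduct of the `X i`. -/
def prodSet {X : ℕ → Type u} (S : ∀ i, Set (X i)) : Set (Ultraproduct ω X) :=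
  {p | ∃ x : ∀ i, X i, mk ω x = p ∧ ∀ᶠ i in (ω : Filter ℕ), x i ∈ S i}

/-- Strongly open sets: ultraproducts of open sets. -/
def IsStronglyOpen {X : ℕ → Type u} [∀ i, TopologicalSpace (X i)]
    (S : Set (Ultraproduct ω X)) : Prop :=
  ∃ U : ∀ i, Set (X i), (∀ i, IsOpen (U i)) ∧ S = prodSet ω U

/-- Open sets of the σ-topology: countable unions of strongly open sets. -/
def IsSigmaOpen {X : ℕ → Type u} [∀ i, TopologicalSpace (X i)]
    (S : Set (Ultraproduct ω X)) : Prop :=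
  ∃ U : ℕ → Set (Ultraproduct ω X), (∀ n, IsStronglyOpen ω (U n)) ∧ S = ⋃ n, U n

/-- Continuity with respect to the σ-topology. -/
def SigmaContinuous {X : ℕ → Type u} [∀ i, TopologicalSpace (X i)]
    {T : Type v} [TopologicalSpace T] (f : Ultraproduct ω X → T) : Prop :=
  ∀ V : Set T, IsOpen V → IsSigmaOpen ω (f ⁻¹' V)

/-- The Borel σ-algebra on the ultraproduct, generated by the strongly open sets. -/
abbrev borelSigma (X : ℕ → Type u) [∀ i, TopologicalSpace (X i)] :
    MeasurableSpace (Ultraproduct ω X) :=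
  MeasurableSpace.generateFrom {S | IsStronglyOpen ω S}

/-- The ultralimit of a sequence of functions with values in a compact Hausdorff space: at the
class of `x` its value is the limit of the points `f i (x i)` along `ω`. -/
noncomputable def ulim {X : ℕ → Type u} {T : Type v} [TopologicalSpace T] [CompactSpace T]
    [T2Space T] (f : ∀ i, X i → T) : Ultraproduct ω X → T :=
  Quotient.lift (fun x : ∀ i, X i => (ω.map (fun i => f i (x i))).lim) (by
    intro x y hxy
    have h : ω.map (fun i => f i (x i)) = ω.map (fun i => f i (y i)) := by
      apply Ultrafilter.coe_injective
      rw [Ultrafilter.coe_map, Ultrafilter.coe_map]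
      refine Filter.map_congr ?_
      filter_upwards [hxy] with i hi
      rw [hi]
    exact congrArg Ultrafilter.lim h)

/-- Linear characters of the ultraproduct of topological abelian groups: homomorphisms to the unit
circle in `ℂ` that are continuous in the σ-topology. -/
def IsLinearCharacter {A : ℕ → Type u} [∀ i, AddCommGroup (A i)] [∀ i, TopologicalSpace (A i)]
    (χ : Ultraproduct ω A → ℂ) : Prop :=
  ∃ ψ : AddChar (Ultraproduct ω A) Circle, SigmaContinuous ω ψ ∧ ∀ p, χ p = (ψ p : ℂ)

end Ultraproduct

/-! Let χ be a character of the ultraproduct. Countable saturation (`exists_finite_cover`) reduces a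
countable cover by strongly open sets on which χ is nearly constant to a finite one, so χ is
uniformly close to internal step functions `f i`. For ω-most `i`, `f i` is nearly multiplicative,
hence close to a homomorphism `ψ i` (`AddChar.exists_dist_le_of_almost_hom`). The rest rests on the
circle having no small subgroups: `ψ i` is continuous because it stays near 1 on a neighbourhood of
0, and χ equals the ultralimit of the `ψ i` because these two characters are uniformly close. -/

namespace Circle

/-! ### Distances and small subgroups in the circle -/

lemma dist_eq_norm_coe (z w : Circle) : dist z w = ‖(z : ℂ) - w‖ := by
  exact dist_eq_norm (z : ℂ) w

/-- Squaring expands distances to 1: z² - 1 = (z - 1)(z + 1), and |z + 1| ≥ 2 - |z - 1| ≥ 3/2. -/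
lemma norm_sub_one_le_of_sq {z : Circle} (h : dist z 1 ≤ 1 / 2) :
    dist z 1 ≤ 2 / 3 * dist (z ^ 2) 1 := by
  simp only [dist_eq_norm_coe] at *
  simp only [Circle.coe_one, Circle.coe_pow] at *
  have h1 : (z : ℂ) ^ 2 - 1 = (z - 1) * (z + 1) := by ring
  have h2 : (2 : ℝ) ≤ ‖(z : ℂ) + 1‖ + ‖(z : ℂ) - 1‖ := by
    have := norm_sub_le ((z : ℂ) + 1) (z - 1)
    have e : (z : ℂ) + 1 - (z - 1) = 2 := by ring
    rw [e] at this
    simpa using this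
  rw [h1, norm_mul]
  nlinarith [norm_nonneg ((z : ℂ) - 1)]

lemma dist_one_le_pow_of_forall_le (n : ℕ) (z : Circle)
    (h : ∀ j ≤ n, dist (z ^ 2 ^ j) 1 ≤ 1 / 2) : dist z 1 ≤ (2 / 3) ^ n := by
  induction n generalizing z with
  | zero => have := h 0 le_rfl; simp only [pow_zero, pow_one] at *; linarith
  | succ n ih =>
    have h0 := h 0 (Nat.zero_le _)
    rw [pow_zero, pow_one] at h0
    have h1 := ih (z ^ 2) fun j hj => by
      rw [← pow_mul, ← pow_succ']
      exact h (j + 1) (by omega)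
    calc dist z 1 ≤ 2 / 3 * dist (z ^ 2) 1 := norm_sub_one_le_of_sq h0
      _ ≤ 2 / 3 * (2 / 3) ^ n := by gcongr
      _ = _ := by ring

/-- The ball of radius `1 / 2` about `1` contains no nontrivial subgroup of the circle. -/
lemma eq_one_of_forall_dist_le {z : Circle} (h : ∀ j : ℕ, dist (z ^ 2 ^ j) 1 ≤ 1 / 2) :
    z = 1 := by
  refine dist_le_zero.mp (ge_of_tendsto' (tendsto_pow_atTop_nhds_zero_of_lt_one
    (by norm_num : (0 : ℝ) ≤ 2 / 3) (by norm_num)) fun n => ?_)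
  exact dist_one_le_pow_of_forall_le n z fun j _ => h j

lemma dist_mul_left' (a b c : Circle) : dist (a * b) (a * c) = dist b c := by
  simp only [dist_eq_norm_coe, Circle.coe_mul, ← mul_sub, norm_mul, Circle.norm_coe, one_mul]

lemma dist_mul_mul_le' (a b c d : Circle) : dist (a * b) (c * d) ≤ dist a c + dist b d := by
  have h1 := dist_triangle (a * b) (a * d) (c * d)
  rw [dist_mul_left' a, mul_comm a d, mul_comm c d, dist_mul_left' d, mul_comm d c] at h1
  linarith

lemma dist_div_one (a b : Circle) : dist (a / b) 1 = dist a b := by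
  rw [← dist_mul_left' b, mul_div_cancel, mul_one]

lemma dist_exp_one_le (t : ℝ) : dist (Circle.exp t) 1 ≤ |t| := by
  rw [dist_eq_norm_coe, Circle.coe_exp, Circle.coe_one, mul_comm]
  exact Real.norm_exp_I_mul_ofReal_sub_one_le

lemma eventually_abs_arg_le {η : ℝ} (hη : 0 < η) :
    ∀ᶠ z : Circle in 𝓝 1, |(z : ℂ).arg| ≤ η := by
  have h : ContinuousAt (fun z : Circle => |(z : ℂ).arg|) 1 := by
    refine ContinuousAt.abs ?_
    exact ContinuousAt.comp (f := fun z : Circle => (z : ℂ)) (g := Complex.arg)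
      (Complex.continuousAt_arg (by simp)) (by fun_prop : Continuous fun z : Circle => (z : ℂ)).continuousAt
  have h2 := (show Tendsto _ _ _ from h).eventually_lt_const (u := η) (by simpa using hη)
  exact h2.mono fun _ hz => le_of_lt hz

end Circle

/-! ### Almost homomorphisms into the circle -/

namespace AddChar

/-- A map to the circle that is close to being a homomorphism is close to a homomorphism. -/
lemma exists_dist_le_of_almost_hom {G : Type*} [AddCommGroup G] (f : G → Circle)
    (hf : ∀ x y, dist (f (x + y)) (f x * f y) ≤ 1 / 20)
    (ha : ∀ x, |((f (x + x) / (f x * f x) : Circle) : ℂ).arg| ≤ 1 / 20) :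
    ∃ ψ : AddChar G Circle, ∀ x, dist (ψ x) (f x) ≤ 1 / 20 := by
  set a : G → ℝ := fun x => ((f (x + x) / (f x * f x) : Circle) : ℂ).arg with ha_def
  have hbound : ∀ x (k : ℕ), ‖a (2 ^ k • x) / 2 / 2 ^ k‖ ≤ (1 / 20 : ℝ) / 2 / 2 ^ k := by
    intro x k
    rw [norm_div, norm_div, norm_pow, Real.norm_eq_abs, Real.norm_ofNat]
    gcongr
    exact ha _
  have hgeo := hasSum_geometric_two' (1 / 20 : ℝ)
  have hsum : ∀ x, Summable fun k : ℕ => a (2 ^ k • x) / 2 / 2 ^ k := fun x =>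
    Summable.of_norm_bounded hgeo.summable (hbound x)
  -- The series solves 2b(x) = a(x) + b(2x), where a is the angular defect of f under doubling; so
  -- f·exp(ib) respects doubling exactly.
  set b : G → ℝ := fun x => ∑' k : ℕ, a (2 ^ k • x) / 2 / 2 ^ k with hb_def
  have hb : ∀ x, |b x| ≤ 1 / 20 := fun x => tsum_of_norm_bounded hgeo (hbound x)
  have hb2 : ∀ x, 2 * b x = a x + b (x + x) := by
    intro x
    have h1 : b x = a x / 2 + ∑' k : ℕ, a (2 ^ (k + 1) • x) / 2 / 2 ^ (k + 1) := by
      rw [hb_def]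
      simp only
      rw [(hsum x).tsum_eq_zero_add]
      simp
    have h2 : ∑' k : ℕ, a (2 ^ (k + 1) • x) / 2 / 2 ^ (k + 1) = b (x + x) / 2 := by
      rw [hb_def]
      simp only
      rw [← tsum_div_const]
      refine tsum_congr fun k => ?_
      rw [← two_nsmul, ← mul_nsmul', pow_succ, div_div _ (2 ^ k), pow_succ]
    rw [h1, h2]
    ring
  set ψ : G → Circle := fun x => f x * Circle.exp (b x) with hψ_def
  have hψf : ∀ x, dist (ψ x) (f x) ≤ 1 / 20 := by
    intro x
    have := Circle.dist_mul_left' (f x) (Circle.exp (b x)) 1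
    rw [mul_one] at this
    rw [hψ_def, this]
    exact (Circle.dist_exp_one_le _).trans (hb x)
  have hψ2 : ∀ x, ψ (x + x) = ψ x ^ 2 := by
    intro x
    have h1 : Circle.exp (a x) = f (x + x) / (f x * f x) := Circle.exp_arg _
    have h2 : Circle.exp (b x) ^ 2 = Circle.exp (a x) * Circle.exp (b (x + x)) := by
      rw [← Circle.exp_add, ← hb2, two_mul, Circle.exp_add, sq]
    simp only [hψ_def]
    rw [mul_pow, h2, h1, sq, ← mul_assoc, mul_div_cancel]
  -- D(x,y)² = D(2x,2y), so every power D^(2^j) is again a value of D and stays near 1; this forces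
  -- D = 1.
  set D : G → G → Circle := fun x y => ψ (x + y) / (ψ x * ψ y) with hD_def
  have hD : ∀ x y, dist (D x y) 1 ≤ 1 / 2 := by
    intro x y
    rw [hD_def, Circle.dist_div_one]
    have h1 := dist_triangle4 (ψ (x + y)) (f (x + y)) (f x * f y) (ψ x * ψ y)
    have h2 := Circle.dist_mul_mul_le' (f x) (f y) (ψ x) (ψ y)
    have h3 := hψf x
    have h4 := hψf y
    rw [dist_comm] at h3 h4
    linarith [hψf (x + y), hf x y]
  have hDpow : ∀ (j : ℕ) x y, D x y ^ 2 ^ j = D (2 ^ j • x) (2 ^ j • y) := by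
    intro j
    induction j with
    | zero => simp
    | succ j ih =>
      intro x y
      have h : D x y ^ 2 = D (2 • x) (2 • y) := by
        simp only [hD_def, two_nsmul]
        rw [add_add_add_comm, hψ2, hψ2, hψ2, div_pow, mul_pow (ψ x)]
      rw [pow_succ', pow_mul, h, ih, ← mul_nsmul, ← mul_nsmul]
  have hD1 : ∀ x y, ψ (x + y) = ψ x * ψ y := by
    intro x y
    refine div_eq_one.mp (Circle.eq_one_of_forall_dist_le (z := D x y) fun j => ?_)
    rw [hDpow]
    exact hD _ _
  have hψ0 : ψ 0 = 1 := by
    have := hD1 0 0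
    rw [add_zero] at this
    exact (left_eq_mul.mp this)
  exact ⟨⟨ψ, hψ0, hD1⟩, hψf⟩

/-- Near 0 the points x, 2x, …, 2^n x all lie in U, and then ψ x is within (2/3)^n of 1. -/
lemma continuous_of_dist_le {G : Type*} [AddCommGroup G] [TopologicalSpace G]
    [IsTopologicalAddGroup G] (ψ : AddChar G Circle) {U : Set G} (hU : U ∈ 𝓝 0)
    (h : ∀ x ∈ U, dist (ψ x) 1 ≤ 1 / 2) : Continuous ψ := by
  have h0 : Tendsto ψ (𝓝 0) (𝓝 1) := by
    rw [Metric.tendsto_nhds]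
    intro ε hε
    obtain ⟨n, hn⟩ := exists_pow_lt_of_lt_one hε (by norm_num : (2 / 3 : ℝ) < 1)
    have hev : ∀ᶠ x in 𝓝 (0 : G), ∀ j ∈ Finset.range (n + 1), 2 ^ j • x ∈ U := by
      rw [Filter.eventually_all_finset]
      intro j _
      have hc : Tendsto (fun x : G => 2 ^ j • x) (𝓝 0) (𝓝 0) := by
        have := (continuous_nsmul (M := G) (2 ^ j)).tendsto 0
        rwa [nsmul_zero] at this
      exact hc hU
    filter_upwards [hev] with x hx
    refine (Circle.dist_one_le_pow_of_forall_le n (ψ x) fun j hj => ?_).trans_lt hn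
    rw [← AddChar.map_nsmul_eq_pow]
    exact h _ (hx j (Finset.mem_range.mpr (by omega)))
  refine continuous_iff_continuousAt.mpr fun x => ?_
  have h1 : Tendsto (fun y => ψ x * ψ (y - x)) (𝓝 x) (𝓝 (ψ x * 1)) := by
    refine tendsto_const_nhds.mul (h0.comp ?_)
    have := (continuous_sub_right x).tendsto x
    rwa [sub_self] at this
  rw [mul_one] at h1
  refine h1.congr fun y => ?_
  rw [← AddChar.map_add_eq_mul, add_sub_cancel]

/-- The values of φ/ψ form a subgroup of the circle inside the ball of radius 1/2 about 1. -/
lemma eq_of_dist_le {G : Type*} [AddCommGroup G] (φ ψ : AddChar G Circle)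
    (h : ∀ x, dist (φ x) (ψ x) ≤ 1 / 2) (x : G) : φ x = ψ x := by
  refine div_eq_one.mp (Circle.eq_one_of_forall_dist_le fun j => ?_)
  rw [div_pow, ← AddChar.map_nsmul_eq_pow, ← AddChar.map_nsmul_eq_pow, Circle.dist_div_one]
  exact h _

end AddChar

/-! ### Saturation and internal approximation -/

namespace Ultraproduct

variable (ω : Ultrafilter ℕ)

lemma mk_eq_mk {X : ℕ → Type u} {x y : ∀ i, X i} :
    mk ω x = mk ω y ↔ ∀ᶠ i in (ω : Filter ℕ), x i = y i :=
  Quotient.eq (r := (ω : Filter ℕ).productSetoid X)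

lemma exists_mk_eq {X : ℕ → Type u} (p : Ultraproduct ω X) : ∃ x, mk ω x = p :=
  Quotient.exists_rep p

lemma mk_mem_prodSet {X : ℕ → Type u} {S : ∀ i, Set (X i)} {x : ∀ i, X i} :
    mk ω x ∈ prodSet ω S ↔ ∀ᶠ i in (ω : Filter ℕ), x i ∈ S i := by
  constructor
  · rintro ⟨y, hy, hS⟩
    filter_upwards [(mk_eq_mk ω).mp hy, hS] with i h1 h2
    rwa [← h1]
  · exact fun h => ⟨x, rfl, h⟩

lemma tendsto_ulim {X : ℕ → Type u} {T : Type v} [TopologicalSpace T] [CompactSpace T]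
    [T2Space T] (f : ∀ i, X i → T) (x : ∀ i, X i) :
    Tendsto (fun i => f i (x i)) ω (𝓝 (ulim ω f (mk ω x))) :=
  (ω.map fun i => f i (x i)).le_nhds_lim

/-- The ultralimit of continuous functions with values in a compact metric space is continuous. -/
lemma sigmaContinuous_ulim {X : ℕ → Type u} [∀ i, TopologicalSpace (X i)] {T : Type v}
    [MetricSpace T] [CompactSpace T] (f : ∀ i, X i → T) (hf : ∀ i, Continuous (f i)) :
    SigmaContinuous ω (ulim ω f) := by
  intro V hV
  -- V must be shrunk: a limit of points of V may leave V, but a limit of points of `W n` keeps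
  -- distance at least 1/(n+1) from the complement.
  let W : ℕ → Set T := fun n => (Metric.cthickening (1 / ((n : ℝ) + 1)) Vᶜ)ᶜ
  have hpos : ∀ n : ℕ, 0 < 1 / ((n : ℝ) + 1) := fun n => Nat.one_div_pos_of_nat
  refine ⟨fun n => prodSet ω fun i => f i ⁻¹' W n, fun n => ⟨_, fun i =>
    Metric.isClosed_cthickening.isOpen_compl.preimage (hf i), rfl⟩, ?_⟩
  ext p
  obtain ⟨x, rfl⟩ := exists_mk_eq ω p
  have ht := tendsto_ulim ω f x
  simp only [Set.mem_preimage, Set.mem_iUnion, mk_mem_prodSet]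
  constructor
  · intro hp
    obtain ⟨ε, hε, hball⟩ := Metric.isOpen_iff.mp hV _ hp
    obtain ⟨n, hn⟩ := exists_nat_one_div_lt hε
    refine ⟨n, ht (Metric.isClosed_cthickening.isOpen_compl.mem_nhds fun hmem => ?_)⟩
    obtain ⟨y, hy, hd⟩ := Metric.mem_thickening_iff.mp
      (Metric.cthickening_subset_thickening' hε hn _ hmem)
    rw [dist_comm] at hd
    exact hy (hball hd)
  · rintro ⟨n, hn⟩
    by_contra hp
    have hmem : Metric.thickening (1 / ((n : ℝ) + 1)) Vᶜ ∈ 𝓝 (ulim ω f (mk ω x)) :=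
      Metric.isOpen_thickening.mem_nhds (Metric.self_subset_thickening (hpos n) _ hp)
    obtain ⟨i, h1, h2⟩ := (hn.and (ht hmem)).exists
    exact h1 (Metric.thickening_subset_cthickening _ _ h2)

/-- Countable saturation by diagonalization: otherwise choose `x i` avoiding as many initial sets as
possible, at most `i` of them. As ω is non-principal, this number tends to infinity along ω, and the
class of `x` lies in no member of the cover. -/
lemma exists_finite_cover {X : ℕ → Type u} [∀ i, Nonempty (X i)]
    (hω : (ω : Filter ℕ) ≤ Filter.cofinite) (U : ℕ → ∀ i, Set (X i))
    (hU : ∀ p : Ultraproduct ω X, ∃ k, p ∈ prodSet ω (U k)) :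
    ∃ K, ∀ᶠ i in (ω : Filter ℕ), ∀ x : X i, ∃ k < K, x ∈ U k i := by
  classical
  by_contra! hcon
  let P : ℕ → ℕ → Prop := fun i K => ∃ x : X i, ∀ k < K, x ∉ U k i
  have hP0 : ∀ i, P i 0 := fun i => ⟨Classical.arbitrary _, by simp⟩
  have hP : ∀ K, ∀ᶠ i in (ω : Filter ℕ), P i K := by
    intro K
    refine (hcon K).mono fun i hi => ?_
    simpa [P] using hi
  have hx : ∀ i, P i (Nat.findGreatest (P i) i) := fun i =>
    Nat.findGreatest_spec (Nat.zero_le i) (hP0 i)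
  choose x hx using hx
  obtain ⟨k, hk⟩ := hU (mk ω x)
  rw [mk_mem_prodSet] at hk
  have hge : ∀ᶠ i in (ω : Filter ℕ), k + 1 ≤ i := by
    have := hω.trans_eq Nat.cofinite_eq_atTop
    exact this (eventually_ge_atTop (k + 1))
  obtain ⟨i, h1, h2, h3⟩ := (hk.and (hge.and (hP (k + 1)))).exists
  exact hx i k (Nat.le_findGreatest h2 h3) h1

/-- Functions continuous for the σ-topology are uniformly approximated by ultralimits of functions
constant on open sets of a countable cover. -/
lemma SigmaContinuous.exists_cover {X : ℕ → Type u} [∀ i, TopologicalSpace (X i)]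
    {T : Type v} [PseudoMetricSpace T] [SecondCountableTopology T] [Nonempty T]
    {g : Ultraproduct ω X → T} (hg : SigmaContinuous ω g) {ε : ℝ} (hε : 0 < ε) :
    ∃ (U : ℕ → ∀ i, Set (X i)) (z : ℕ → T), (∀ k i, IsOpen (U k i)) ∧
      (∀ p, ∃ k, p ∈ prodSet ω (U k)) ∧ ∀ k, ∀ p ∈ prodSet ω (U k), dist (g p) (z k) < ε := by
  have h : ∀ m : ℕ, ∃ U : ℕ → ∀ i, Set (X i), (∀ n i, IsOpen (U n i)) ∧
      g ⁻¹' Metric.ball (TopologicalSpace.denseSeq T m) ε = ⋃ n, prodSet ω (U n) := by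
    intro m
    obtain ⟨S, hS, hS'⟩ := hg _ (Metric.isOpen_ball (x := TopologicalSpace.denseSeq T m) (ε := ε))
    choose U hU hU' using hS
    exact ⟨U, hU, by rw [hS']; exact Set.iUnion_congr hU'⟩
  choose U hU hU' using h
  refine ⟨fun k => U k.unpair.1 k.unpair.2,
    fun k => TopologicalSpace.denseSeq T k.unpair.1, fun k i => hU _ _ _, fun p => ?_,
    fun k p hp => ?_⟩
  · obtain ⟨m, hm⟩ := (TopologicalSpace.denseRange_denseSeq T).exists_dist_lt (g p) hε
    have : p ∈ ⋃ n, prodSet ω (U m n) := by rw [← hU' m]; exact hm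
    obtain ⟨n, hn⟩ := Set.mem_iUnion.mp this
    exact ⟨Nat.pair m n, by simpa using hn⟩
  · have : p ∈ g ⁻¹' Metric.ball (TopologicalSpace.denseSeq T k.unpair.1) ε := by
      rw [hU']; exact Set.mem_iUnion.mpr ⟨_, hp⟩
    exact this

/-- A function continuous for the σ-topology is uniformly approximated by an internal function. -/
lemma exists_internal_approx {X : ℕ → Type u} [∀ i, Nonempty (X i)]
    (hω : (ω : Filter ℕ) ≤ Filter.cofinite) {T : Type v} [PseudoMetricSpace T]
    {g : Ultraproduct ω X → T} {ε : ℝ} (U : ℕ → ∀ i, Set (X i)) (z : ℕ → T)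
    (hU : ∀ p, ∃ k, p ∈ prodSet ω (U k)) (hz : ∀ k, ∀ p ∈ prodSet ω (U k), dist (g p) (z k) < ε) :
    ∃ f : ∀ i, X i → T, ∀ x : ∀ i, X i,
      ∀ᶠ i in (ω : Filter ℕ), dist (g (mk ω x)) (f i (x i)) < ε := by
  obtain ⟨K, hK⟩ := exists_finite_cover ω hω U hU
  have hex : ∀ i (x : X i), ∃ k, (∃ k < K, x ∈ U k i) → k < K ∧ x ∈ U k i := by
    intro i x
    by_cases h : ∃ k < K, x ∈ U k i
    · exact h.imp fun k hk _ => hk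
    · exact ⟨0, fun h' => (h h').elim⟩
  choose κ hκ using hex
  refine ⟨fun i x => z (κ i x), fun x => ?_⟩
  have h1 : ∀ᶠ i in (ω : Filter ℕ), κ i (x i) < K ∧ x i ∈ U (κ i (x i)) i :=
    hK.mono fun i hi => hκ i _ (hi _)
  -- Only finitely many indices occur, so the ultrafilter selects one that is constant along ω.
  have h2 : ∀ᶠ i in (ω : Filter ℕ), ∃ k ∈ Set.Iio K, κ i (x i) = k :=
    h1.mono fun i hi => ⟨_, hi.1, rfl⟩
  obtain ⟨k, -, hk⟩ := (Ultrafilter.eventually_exists_mem_iff (Set.finite_Iio K)).mp h2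
  have h3 : mk ω x ∈ prodSet ω (U k) := by
    rw [mk_mem_prodSet]
    filter_upwards [h1, hk] with i hi hki
    rw [← hki]
    exact hi.2
  filter_upwards [hk] with i hi
  rw [hi]
  exact hz k _ h3

/-- A property that holds eventually along every sequence holds eventually everywhere. -/
lemma eventually_forall_of_forall {ω : Ultrafilter ℕ} {Y : ℕ → Type u} [∀ i, Nonempty (Y i)]
    {P : ∀ i, Y i → Prop} (h : ∀ y : ∀ i, Y i, ∀ᶠ i in (ω : Filter ℕ), P i (y i)) :
    ∀ᶠ i in (ω : Filter ℕ), ∀ y, P i y := by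
  -- `y i` is a counterexample to `P i` whenever one exists.
  have hex : ∀ i, ∃ y, P i y → ∀ y, P i y := by
    intro i
    by_cases hi : ∀ y, P i y
    · exact ⟨Classical.arbitrary _, fun _ => hi⟩
    · push Not at hi
      exact hi.imp fun y hy h' => (hy h').elim
  choose y hy using hex
  exact (h y).mono hy

/-! ### Characters of the ultraproduct -/

variable {A : ℕ → Type u} [∀ i, AddCommGroup (A i)]

/-- The ultralimit of characters is a character. -/
noncomputable def ulimChar (ψ : ∀ i, AddChar (A i) Circle) : AddChar (Ultraproduct ω A) Circle where
  toFun := ulim ω fun i => (ψ i : A i → Circle)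
  map_zero_eq_one' := by
    refine tendsto_nhds_unique (tendsto_ulim ω (fun i => (ψ i : A i → Circle)) fun _ => 0) ?_
    simp
  map_add_eq_mul' p q := by
    obtain ⟨x, rfl⟩ := exists_mk_eq ω p
    obtain ⟨y, rfl⟩ := exists_mk_eq ω q
    have hx := tendsto_ulim ω (fun i => (ψ i : A i → Circle)) x
    have hy := tendsto_ulim ω (fun i => (ψ i : A i → Circle)) y
    refine tendsto_nhds_unique
      (tendsto_ulim ω (fun i => (ψ i : A i → Circle)) fun i => x i + y i) ?_
    simpa only [AddChar.map_add_eq_mul] using hx.mul hy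

variable [∀ i, TopologicalSpace (A i)]

lemma exists_ulim_eq [∀ i, IsTopologicalAddGroup (A i)] (hω : (ω : Filter ℕ) ≤ Filter.cofinite)
    (χ : AddChar (Ultraproduct ω A) Circle) (hχ : SigmaContinuous ω χ) :
    ∃ ψ : ∀ i, AddChar (A i) Circle, (∀ i, Continuous (ψ i)) ∧
      ∀ p, χ p = ulim ω (fun i => (ψ i : A i → Circle)) p := by
  obtain ⟨δ, hδ, hδarg⟩ := Metric.eventually_nhds_iff.mp
    (Circle.eventually_abs_arg_le (η := 1 / 20) (by norm_num))
  -- Each comparison below replaces χ by an approximation three times, at a cost of ε each; 3ε must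
  -- meet both defect bounds for almost homomorphisms.
  obtain ⟨ε, hε, hε1, hε2⟩ : ∃ ε : ℝ, 0 < ε ∧ 3 * ε ≤ 1 / 20 ∧ 3 * ε ≤ δ :=
    ⟨min (1 / 60) (δ / 3), by positivity, by linarith [min_le_left (1 / 60) (δ / 3)],
      by linarith [min_le_right (1 / 60) (δ / 3)]⟩
  obtain ⟨U, z, hUo, hU, hz⟩ := hχ.exists_cover ω hε
  obtain ⟨f, hf⟩ := exists_internal_approx ω hω U z hU hz
  have hhom : ∀ᶠ i in (ω : Filter ℕ), ∀ y : A i × A i,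
      dist (f i (y.1 + y.2)) (f i y.1 * f i y.2) < 3 * ε := by
    refine eventually_forall_of_forall fun y => ?_
    filter_upwards [hf fun i => (y i).1, hf fun i => (y i).2, hf fun i => (y i).1 + (y i).2]
      with i h1 h2 h3
    have e : χ (mk ω fun i => (y i).1 + (y i).2)
        = χ (mk ω fun i => (y i).1) * χ (mk ω fun i => (y i).2) :=
      χ.map_add_eq_mul (mk ω fun i => (y i).1) (mk ω fun i => (y i).2)
    have h4 := Circle.dist_mul_mul_le' (χ (mk ω fun i => (y i).1)) (χ (mk ω fun i => (y i).2))
      (f i (y i).1) (f i (y i).2)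
    rw [← e] at h4
    have h5 := dist_triangle_left (f i ((y i).1 + (y i).2)) (f i (y i).1 * f i (y i).2)
      (χ (mk ω fun i => (y i).1 + (y i).2))
    linarith
  -- The piece containing 0 supplies the neighbourhood for continuity: on it χ is within 2ε of χ(0)
  -- = 1, hence `f i` is within 3ε of 1.
  obtain ⟨k, hk⟩ := hU (mk ω fun _ => 0)
  have hχ0 : χ (mk ω fun _ => 0) = 1 := χ.map_zero_eq_one
  have hone : ∀ᶠ i in (ω : Filter ℕ), ∀ y : A i, y ∈ U k i → dist (f i y) 1 < 3 * ε := by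
    refine eventually_forall_of_forall fun y => ?_
    by_cases hy : mk ω y ∈ prodSet ω (U k)
    · filter_upwards [hf y] with i hi _
      have h1 := hz k _ hy
      have h2 := hz k _ hk
      rw [hχ0] at h2
      rw [dist_comm] at hi
      have h3 := dist_triangle4 (f i (y i)) (χ (mk ω y)) (z k) 1
      rw [dist_comm (z k)] at h3
      linarith
    · rw [mk_mem_prodSet, ← Ultrafilter.eventually_not] at hy
      exact hy.mono fun i hi h => (hi h).elim
  have hgood : ∀ᶠ i in (ω : Filter ℕ), ∃ ψ : AddChar (A i) Circle, Continuous ψ ∧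
      ∀ x, dist (ψ x) (f i x) ≤ 1 / 20 := by
    filter_upwards [hhom, hone, (mk_mem_prodSet ω).mp hk] with i h1 h2 h3
    obtain ⟨ψ, hψ⟩ := AddChar.exists_dist_le_of_almost_hom (f i)
      (fun x y => (h1 (x, y)).le.trans hε1) fun x => hδarg <| by
        rw [Circle.dist_div_one]
        exact (h1 (x, x)).trans_le hε2
    refine ⟨ψ, ψ.continuous_of_dist_le ((hUo k i).mem_nhds h3) fun x hx => ?_, hψ⟩
    linarith [dist_triangle (ψ x) (f i x) 1, hψ x, h2 x hx]
  have hex : ∀ i, ∃ ψ : AddChar (A i) Circle, Continuous ψ ∧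
      ((∃ ψ : AddChar (A i) Circle, Continuous ψ ∧ ∀ x, dist (ψ x) (f i x) ≤ 1 / 20) →
        ∀ x, dist (ψ x) (f i x) ≤ 1 / 20) := by
    intro i
    by_cases h : ∃ ψ : AddChar (A i) Circle, Continuous ψ ∧ ∀ x, dist (ψ x) (f i x) ≤ 1 / 20
    · exact h.imp fun ψ hψ => ⟨hψ.1, fun _ => hψ.2⟩
    -- The trivial character fills the ω-null set of bad indices.
    · exact ⟨1, continuous_const, fun h' => (h h').elim⟩
  choose ψ hψc hψ using hex
  -- Both characters are close to `f`, at total distance at most ε + 1/20, well below 1/2.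
  refine ⟨ψ, hψc, AddChar.eq_of_dist_le χ (ulimChar ω ψ) fun p => ?_⟩
  obtain ⟨x, rfl⟩ := exists_mk_eq ω p
  have ht := tendsto_ulim ω (fun i => (ψ i : A i → Circle)) x
  refine le_of_tendsto (tendsto_const_nhds.dist ht) ?_
  filter_upwards [hf x, hgood] with i h1 h2
  have h3 := hψ i h2 (x i)
  rw [dist_comm] at h3
  linarith [dist_triangle (χ (mk ω x)) (f i (x i)) (ψ i (x i))]

lemma IsSigmaOpen.measurableSet {X : ℕ → Type u} [∀ i, TopologicalSpace (X i)]
    {S : Set (Ultraproduct ω X)} (hS : IsSigmaOpen ω S) : MeasurableSet[borelSigma ω X] S := by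
  obtain ⟨U, hU, rfl⟩ := hS
  exact MeasurableSet.iUnion fun n => MeasurableSpace.measurableSet_generateFrom (hU n)

lemma SigmaContinuous.continuous_comp {X : ℕ → Type u} [∀ i, TopologicalSpace (X i)]
    {T : Type v} [TopologicalSpace T] {T' : Type*} [TopologicalSpace T']
    {f : Ultraproduct ω X → T} (hf : SigmaContinuous ω f) {g : T → T'} (hg : Continuous g) :
    SigmaContinuous ω (fun p => g (f p)) :=
  fun V hV => hf (g ⁻¹' V) (hV.preimage hg)

lemma SigmaContinuous.measurable {X : ℕ → Type u} [∀ i, TopologicalSpace (X i)]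
    {T : Type v} [TopologicalSpace T] [MeasurableSpace T] [BorelSpace T]
    {f : Ultraproduct ω X → T} (hf : SigmaContinuous ω f) : Measurable[borelSigma ω X] f :=
  @measurable_of_isOpen _ _ _ _ _ (borelSigma ω X) f fun V hV => (hf V hV).measurableSet

end Ultraproduct

theorem mainTheorem12 (ω : Ultrafilter ℕ) (hω : (ω : Filter ℕ) ≤ Filter.cofinite)
    (A : ℕ → Type u) [∀ i, AddCommGroup (A i)] [∀ i, TopologicalSpace (A i)]
    [∀ i, IsTopologicalAddGroup (A i)] [∀ i, CompactSpace (A i)] [∀ i, T2Space (A i)] :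
    (∀ χ : Ultraproduct ω A → ℂ,
      Ultraproduct.IsLinearCharacter ω χ ↔
        ∃ ψ : ∀ i, AddChar (A i) Circle, (∀ i, Continuous (ψ i)) ∧
          ∀ p, χ p = ((Ultraproduct.ulim ω (fun i => (ψ i : A i → Circle)) p : Circle) : ℂ)) ∧
    (∀ χ : Ultraproduct ω A → ℂ, Ultraproduct.IsLinearCharacter ω χ →
      Measurable[Ultraproduct.borelSigma ω A] χ ∧ ∀ p, ‖χ p‖ = 1) := by
  refine ⟨fun χ => ⟨?_, ?_⟩, ?_⟩
  · rintro ⟨ψ, hψ, hχ⟩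
    obtain ⟨φ, hφ, h⟩ := Ultraproduct.exists_ulim_eq ω hω ψ hψ
    exact ⟨φ, hφ, fun p => by rw [hχ, h]⟩
  · rintro ⟨ψ, hψ, hχ⟩
    exact ⟨Ultraproduct.ulimChar ω ψ, Ultraproduct.sigmaContinuous_ulim ω _ hψ, hχ⟩
  · rintro χ ⟨ψ, hψ, hχ⟩
    refine ⟨?_, fun p => by rw [hχ, Circle.norm_coe]⟩
    obtain rfl : χ = fun p => (ψ p : ℂ) := funext hχ
    exact (hψ.continuous_comp ω (g := fun z : Circle => (z : ℂ)) (by fun_prop)).measurable ω
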